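/- **Theorem 6.1 (subdifferential sum rule).** Let $X$ be a separated (Hausdorff) real locally convex topological vector space with topological dual $X^*$. Let $f,g\colon X\to(-\infty,\infty]$ be convex and proper, that is, their epigraphs $\{(x,\mu)\in X\times\mathbb{R}:\mu\ge f(x)\}$ and $\{(x,\mu)\in X\times\mathbb{R}:\mu\ge g(x)\}$ are convex and their domains $\operatorname{dom} f=\{x\in X: f(x)<\infty\}$ and $\operatorname{dom} g=\{x\in X: g(x)<\infty\}$ are nonempty. For $h\colon X\to(-\infty,\infty]$ and $\bar x\in\operatorname{dom}h$ put $$\partial h(\bar x)=\{x^*\in X^*:\ \langle x^*,x-\bar x\rangle\le h(x)-h(\bar x)\ \text{ for all }x\in X\}.$$ Suppose that one of the following two conditions holds: (i) $f$ is finite and continuous at some point of $\operatorname{dom} f\cap\operatorname{dom} g$; (ii) $X$ is a Banach space, $f$ and $g$ are lower semicontinuous, and $\mathbb{R}^+(\operatorname{dom} f-\operatorname{dom} g)=\{t(u-v): t>0,\ u\in\operatorname{dom} f,\ v\in\operatorname{dom} g\}$ is a closed linear subspace of $X$. Then $$\partial(f+g)(\bar x)=\partial f(\bar x)+\partial g(\bar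 x)\qquad\text{for all }\bar x\in\operatorname{dom} f\cap\operatorname{dom} g,$$ where the right-hand side is the set of all sums $x_1^*+x_2^*$ with $x_1^*\in\partial f(\bar x)$ and $x_2^*\in\partial g(\bar x)$. -/

import Mathlib

open scoped Pointwise

namespace SubdiffSum

/-- Properness of an extended-real-valued function: it takes its values in `(-∞, ∞]` and is not
identically `∞`. -/
def IsProper {X : Type*} (f : X → EReal) : Prop :=
  (∀ x, f x ≠ ⊥) ∧ ∃ x, f x < ⊤

/-- The effective domain `dom f = {x | f x < ∞}`. -/
def effDom {X : Type*} (f : X → EReal) : Set X :=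
  {x | f x < ⊤}

/-- The epigraph `epi f = {(x, μ) ∈ X × ℝ | μ ≥ f x}`. -/
def epi {X : Type*} (f : X → EReal) : Set (X × ℝ) :=
  {p | f p.1 ≤ (p.2 : EReal)}

/-- Convexity of an extended-real-valued function, i.e. convexity of its epigraph. -/
def IsConvexFun {X : Type*} [AddCommGroup X] [Module ℝ X] (f : X → EReal) : Prop :=
  Convex ℝ (epi f)

/-- The cone `ℝ⁺(Ω) = {t v | t > 0, v ∈ Ω}`. -/
def posCone {X : Type*} [AddCommGroup X] [Module ℝ X] (Ω : Set X) : Set X :=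
  {x | ∃ t : ℝ, 0 < t ∧ ∃ v ∈ Ω, x = t • v}

/-- The convex subdifferential `∂f(x₀)`: all continuous linear functionals `φ` such that
`φ (x - x₀) ≤ f x - f x₀` for every `x`. It is used at points where `f x₀` is finite, so that the
difference on the right has its ordinary meaning; it is empty when `f x₀ = ⊤`. -/
def subdiff {X : Type*} [AddCommGroup X] [Module ℝ X] [TopologicalSpace X]
    (f : X → EReal) (x₀ : X) : Set (X →L[ℝ] ℝ) :=
  {φ | ∀ x, ((φ (x - x₀) : ℝ) : EReal) ≤ f x - f x₀}

end SubdiffSum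

open SubdiffSum

/-! Only the splitting of a given `φ ∈ ∂(f+g)(x₀)` is hard. Let `h y = inf {f u + g v - φ v | u - v
= y}`, a convex function whose value at `0` is attained at `u = v = x₀`, because `φ` is a
subgradient. A subgradient `ψ` of `h` at `0` splits `φ` as `ψ + (φ - ψ)` (`mem_add_subdiff`).
Hahn-Banach gives `ψ` once `h` is bounded above near `0` (`Convex.exists_affine_minorant`). Under
(i), continuity of `f` gives this bound. Under (ii), it holds on the closed subspace `L` by Baire
category and the successive approximations of the open mapping theorem (`exists_bound_near_zero`);
the functional found on `L` is then extended to `X`. -/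

/-! ### Separation by a non-vertical hyperplane -/

open Set Filter Topology in
/-- A convex set in `E × ℝ` lying above the height `m` over `0`, and having an interior point over
`0`, lies above a non-vertical hyperplane through `(0, m)`. -/
theorem Convex.exists_affine_minorant {E : Type*} [AddCommGroup E] [Module ℝ E]
    [TopologicalSpace E] [IsTopologicalAddGroup E] [ContinuousSMul ℝ E] {C : Set (E × ℝ)}
    (hC : Convex ℝ C) {m M : ℝ} (hM : ((0 : E), M) ∈ interior C)
    (hm : ∀ μ : ℝ, ((0 : E), μ) ∈ C → m ≤ μ) :
    ∃ ψ : E →L[ℝ] ℝ, ∀ p ∈ C, m + ψ p.1 ≤ p.2 := by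
  have hnot : ((0 : E), m) ∉ interior C := by
    intro h
    have hcont : Continuous fun μ : ℝ => ((0 : E), μ) := by fun_prop
    have hmem : ∀ᶠ μ in 𝓝 m, ((0 : E), μ) ∈ interior C :=
      hcont.continuousAt.eventually_mem (isOpen_interior.mem_nhds h)
    have hlt : ∀ᶠ μ in 𝓝[<] m, ((0 : E), μ) ∈ interior C ∧ μ < m :=
      (hmem.filter_mono nhdsWithin_le_nhds).and self_mem_nhdsWithin
    obtain ⟨μ, hμ, hlt⟩ := hlt.exists
    exact absurd (hm μ (interior_subset hμ)) (not_le.2 hlt)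
  obtain ⟨l, hl⟩ := geometric_hahn_banach_open_point hC.interior isOpen_interior hnot
  set c := l (0, 1) with hc
  have hsplit : ∀ (y : E) (μ : ℝ), l (y, μ) = l (y, 0) + c * μ := by
    intro y μ
    have : ((y, μ) : E × ℝ) = (y, 0) + μ • (0, 1) := by simp
    rw [this, map_add, map_smul, smul_eq_mul, mul_comm]
  have h0 : l ((0 : E), (0 : ℝ)) = 0 := map_zero l
  -- Both `(0, M)` and `(0, m)` lie over `0`, so `l` separates them through `c` alone: the
  -- hyperplane cannot be vertical.
  have hcneg : c < 0 := by
    have h1 := hl _ hM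
    have h2 := hm M (interior_subset hM)
    rw [hsplit 0 M, hsplit 0 m, h0] at h1
    by_contra! hcn
    nlinarith [mul_le_mul_of_nonneg_left h2 hcn]
  refine ⟨(-c⁻¹) • l.comp (ContinuousLinearMap.inl ℝ E ℝ), ?_⟩
  rintro ⟨y, μ⟩ hp
  -- Separation is known only on the interior, which is dense in `C` by convexity.
  have hcl : ((y, μ) : E × ℝ) ∈ closure (interior C) := by
    rw [hC.closure_interior_eq_closure_of_nonempty_interior ⟨_, hM⟩]
    exact subset_closure hp
  have hle : l (y, μ) ≤ l (0, m) :=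
    closure_minimal (fun q hq => (hl q hq).le)
      (isClosed_le l.continuous continuous_const) hcl
  rw [hsplit y μ, hsplit 0 m, h0] at hle
  have : m + -c⁻¹ * l (y, 0) ≤ μ := by
    have h3 : c * (m + -c⁻¹ * l (y, 0)) = c * m - l (y, 0) := by
      rw [mul_add, ← mul_assoc, mul_neg, mul_inv_cancel₀ hcneg.ne]
      ring
    by_contra! hcon
    have := mul_lt_mul_of_neg_left hcon hcneg
    linarith
  simpa using this

/-! ### Open mapping for convex sets -/

section OpenMapping

variable {E Y : Type*} [NormedAddCommGroup E] [NormedSpace ℝ E] [NormedAddCommGroup Y]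
  [NormedSpace ℝ Y]

open Filter Topology in
/-- If the closure of the image of a bounded closed convex set contains a ball around `0`, then the
image itself contains the ball of half the radius. -/
theorem Convex.ball_half_subset_image [CompleteSpace E] {S : Set E} (hS : Convex ℝ S)
    (hcl : IsClosed S) (hb : Bornology.IsBounded S) (T : E →L[ℝ] Y) {r : ℝ}
    (h : Metric.ball (0 : Y) r ⊆ closure (T '' S)) :
    Metric.ball (0 : Y) (r / 2) ⊆ T '' S := by
  intro z hz
  have hr : 0 < r := by
    have := (norm_nonneg z).trans_lt (mem_ball_zero_iff.1 hz)
    linarith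
  have hex : ∀ y : Metric.ball (0 : Y) r, ∃ s ∈ S, ‖(y : Y) - T s‖ < r / 2 := by
    intro y
    obtain ⟨_, ⟨s, hs, rfl⟩, hd⟩ := Metric.mem_closure_iff.1 (h y.2) (r / 2) (half_pos hr)
    exact ⟨s, hs, by rwa [← dist_eq_norm]⟩
  choose σ hσ hσd using hex
  -- The error is below `r / 2`, so doubling it returns to the ball and the approximation can be
  -- iterated.
  let next : Metric.ball (0 : Y) r → Metric.ball (0 : Y) r := fun y =>
    ⟨(2 : ℝ) • ((y : Y) - T (σ y)), by
      rw [mem_ball_zero_iff, norm_smul, Real.norm_two]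
      linarith [hσd y]⟩
  have h2z : (2 : ℝ) • z ∈ Metric.ball (0 : Y) r := by
    rw [mem_ball_zero_iff] at hz ⊢
    rw [norm_smul, Real.norm_two]
    linarith
  let y : ℕ → Metric.ball (0 : Y) r := fun n => next^[n] ⟨_, h2z⟩
  have hy : ∀ n, (y (n + 1) : Y) = (2 : ℝ) • ((y n : Y) - T (σ (y n))) := by
    intro n
    simp only [y, Function.iterate_succ_apply']
    rfl
  let t : ℕ → E := fun k => ((1 : ℝ) / 2) ^ (k + 1) • σ (y k)
  -- The weights `1/2, 1/4, ...` leave mass `2⁻ⁿ`; placing it on `p` gives a convex combination.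
  have hpartial : ∀ n, ∀ p ∈ S, ∑ k ∈ Finset.range n, t k + ((1 : ℝ) / 2) ^ n • p ∈ S := by
    intro n
    induction n with
    | zero => intro p hp; simpa using hp
    | succ n ih =>
      intro p hp
      have hmid := hS (hσ (y n)) hp (by norm_num : (0 : ℝ) ≤ 1 / 2)
        (by norm_num : (0 : ℝ) ≤ 1 / 2) (by norm_num)
      convert ih _ hmid using 1
      rw [Finset.sum_range_succ, smul_add, smul_smul, smul_smul, ← pow_succ, add_assoc]
  obtain ⟨B, hB⟩ := hb.exists_norm_le
  have hgeom : Summable fun k : ℕ => ((1 : ℝ) / 2) ^ (k + 1) * B :=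
    ((summable_nat_add_iff 1).2 summable_geometric_two).mul_right B
  have hsum : Summable t := by
    refine Summable.of_norm_bounded hgeom fun k => ?_
    rw [norm_smul, Real.norm_of_nonneg (by positivity)]
    exact mul_le_mul_of_nonneg_left (hB _ (hσ _)) (by positivity)
  have hpow : Tendsto (fun n : ℕ => ((1 : ℝ) / 2) ^ n) atTop (𝓝 0) :=
    tendsto_pow_atTop_nhds_zero_of_lt_one (by norm_num) (by norm_num)
  have hlim := hsum.hasSum.tendsto_sum_nat
  have hmem : ∑' k, t k ∈ S := by
    have h1 : Tendsto (fun n => ∑ k ∈ Finset.range n, t k + ((1 : ℝ) / 2) ^ n • σ (y 0)) atTop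
        (𝓝 (∑' k, t k + (0 : ℝ) • σ (y 0))) := hlim.add (hpow.smul_const _)
    rw [zero_smul, add_zero] at h1
    exact hcl.mem_of_tendsto h1 (Eventually.of_forall fun n => hpartial n _ (hσ _))
  refine ⟨_, hmem, ?_⟩
  have htel : ∀ n, T (∑ k ∈ Finset.range n, t k) = z - ((1 : ℝ) / 2) ^ (n + 1) • (y n : Y) := by
    intro n
    induction n with
    | zero => simp [y, smul_smul]
    | succ n ih =>
      rw [Finset.sum_range_succ, map_add, ih, hy, smul_smul, map_smul]
      have : ((1 : ℝ) / 2) ^ (n + 1 + 1) * 2 = (1 / 2) ^ (n + 1) := by ring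
      rw [this, smul_sub]
      abel
  have h1 : Tendsto (fun n => T (∑ k ∈ Finset.range n, t k)) atTop (𝓝 (T (∑' k, t k))) :=
    (T.continuous.tendsto _).comp hlim
  have hsmall : Tendsto (fun n => ((1 : ℝ) / 2) ^ (n + 1) • (y n : Y)) atTop (𝓝 0) := by
    refine squeeze_zero_norm (a := fun n => ((1 : ℝ) / 2) ^ (n + 1) * r) (fun n => ?_) ?_
    · rw [norm_smul, Real.norm_of_nonneg (by positivity)]
      exact mul_le_mul_of_nonneg_left (mem_ball_zero_iff.1 (y n).2).le (by positivity)
    · simpa using ((tendsto_add_atTop_iff_nat 1).2 hpow).mul_const r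
  have h2 : Tendsto (fun n => T (∑ k ∈ Finset.range n, t k)) atTop (𝓝 (z - 0)) := by
    simp_rw [htel]
    exact tendsto_const_nhds.sub hsmall
  rw [sub_zero] at h2
  exact tendsto_nhds_unique h1 h2

open Filter Topology Pointwise in
/-- If the images of an increasing sequence of closed convex sets under a continuous linear map
have an absorbing union, then one of these images is a neighbourhood of `0`. -/
theorem exists_ball_subset_image_of_absorbing [CompleteSpace E] [CompleteSpace Y]
    (T : E →L[ℝ] Y) {S : ℕ → Set E} (hmono : Monotone S) (hconv : ∀ n, Convex ℝ (S n))
    (hclosed : ∀ n, IsClosed (S n))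
    (habs : ∀ y : Y, ∃ t : ℝ, 0 < t ∧ ∃ n, ∃ e ∈ S n, y = t • T e) :
    ∃ n, ∃ r > 0, Metric.ball (0 : Y) r ⊆ T '' S n := by
  -- Truncation supplies the boundedness that makes the approximating series converge.
  let B : ℕ → Set E := fun n => S n ∩ Metric.closedBall 0 n
  have hBmono : Monotone B := fun m n h =>
    Set.inter_subset_inter (hmono h) (Metric.closedBall_subset_closedBall (by exact_mod_cast h))
  have hBconv : ∀ n, Convex ℝ (B n) := fun n => (hconv n).inter (convex_closedBall _ _)
  have habsB : ∀ y : Y, ∃ t : ℝ, 0 < t ∧ ∃ n, ∃ e ∈ B n, y = t • T e := by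
    intro y
    obtain ⟨t, ht, n, e, he, hy⟩ := habs y
    obtain ⟨k, hk⟩ := exists_nat_ge ‖e‖
    refine ⟨t, ht, max n k, e, ⟨hmono (le_max_left _ _) he, ?_⟩, hy⟩
    rw [mem_closedBall_zero_iff]
    exact hk.trans (by exact_mod_cast le_max_right _ _)
  -- A point `e₀` of the kernel lets image points be shrunk towards `0` by convexity.
  obtain ⟨t₀, ht₀, n₀, e₀, he₀, hz⟩ := habsB 0
  have hTe₀ : T e₀ = 0 := by
    rcases smul_eq_zero.1 hz.symm with h | h
    · exact absurd h ht₀.ne'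
    · exact h
  have hscale : ∀ y : Y, ∃ N : ℕ, ∀ n ≥ N, ∀ s : ℝ, (N : ℝ) < s → s⁻¹ • y ∈ T '' B n := by
    intro y
    obtain ⟨t, ht, k, e, he, rfl⟩ := habsB y
    obtain ⟨j, hj⟩ := exists_nat_ge t
    refine ⟨max j (max k n₀), fun n hn s hs => ?_⟩
    have hk : k ≤ n := (le_max_left _ _).trans ((le_max_right _ _).trans hn)
    have h0 : n₀ ≤ n := (le_max_right _ _).trans ((le_max_right _ _).trans hn)
    have hts : t < s :=
      (hj.trans (by exact_mod_cast le_max_left _ _)).trans_lt hs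
    have hs0 : 0 < s := ht.trans hts
    refine ⟨(t / s) • e + (1 - t / s) • e₀, hBconv n (hBmono hk he) (hBmono h0 he₀)
      (by positivity) (sub_nonneg.2 ((div_le_one hs0).2 hts.le)) (by ring), ?_⟩
    rw [map_add, map_smul, map_smul, hTe₀, smul_zero, add_zero, smul_smul, div_eq_inv_mul]
  -- Symmetry turns any interior point of the closure into `0`, the midpoint of `w` and `-w`.
  let D : ℕ → Set Y := fun n => T '' B n ∩ -(T '' B n)
  have hDconv : ∀ n, Convex ℝ (D n) := fun n =>
    ((hBconv n).linear_image (T : E →ₗ[ℝ] Y)).inter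
      ((hBconv n).linear_image (T : E →ₗ[ℝ] Y)).neg
  have hcover : ⋃ n : ℕ, closure (((n : ℝ) + 1) • D n) = Set.univ := by
    refine Set.eq_univ_of_forall fun y => ?_
    obtain ⟨N, hN⟩ := hscale y
    obtain ⟨N', hN'⟩ := hscale (-y)
    refine Set.mem_iUnion.2 ⟨max N N', subset_closure ?_⟩
    have hpos : (0 : ℝ) < (max N N' : ℕ) + 1 := by positivity
    rw [Set.mem_smul_set_iff_inv_smul_mem₀ hpos.ne']
    have hl : (N : ℝ) < (max N N' : ℕ) + 1 := by
      exact_mod_cast Nat.lt_succ_of_le (le_max_left _ _)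
    have hr : (N' : ℝ) < (max N N' : ℕ) + 1 := by
      exact_mod_cast Nat.lt_succ_of_le (le_max_right _ _)
    refine ⟨hN _ (le_max_left _ _) _ hl, ?_⟩
    rw [Set.mem_neg, ← smul_neg]
    exact hN' _ (le_max_right _ _) _ hr
  obtain ⟨n, x, hx⟩ := nonempty_interior_of_iUnion_of_closed (fun n => isClosed_closure) hcover
  have hpos : (0 : ℝ) < (n : ℝ) + 1 := by positivity
  rw [closure_smul₀, interior_smul₀ hpos.ne', Set.mem_smul_set_iff_inv_smul_mem₀ hpos.ne'] at hx
  set w := ((n : ℝ) + 1)⁻¹ • x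
  have hneg : -w ∈ interior (closure (D n)) := by
    have hsymm : -D n = D n := by
      simp only [D, Set.inter_neg, neg_neg]
      exact Set.inter_comm _ _
    have : -interior (closure (D n)) = interior (closure (D n)) := by
      have h1 := (Homeomorph.neg Y).preimage_closure (D n)
      have h2 := (Homeomorph.neg Y).preimage_interior (closure (D n))
      simp only [Homeomorph.coe_neg, Set.neg_preimage, hsymm] at h1 h2
      rw [h2, h1]
    rw [← this]
    simpa using hx
  have h0 : (0 : Y) ∈ interior (closure (D n)) := by
    have := (hDconv n).closure.interior hx hneg (by norm_num : (0 : ℝ) ≤ 1 / 2)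
      (by norm_num : (0 : ℝ) ≤ 1 / 2) (by norm_num)
    simpa using this
  obtain ⟨r, hr, hball⟩ := Metric.isOpen_iff.1 isOpen_interior 0 h0
  refine ⟨n, r / 2, half_pos hr, ?_⟩
  refine ((hBconv n).ball_half_subset_image ((hclosed n).inter Metric.isClosed_closedBall)
    (Metric.isBounded_closedBall.subset Set.inter_subset_right) T ?_).trans
    (Set.image_mono Set.inter_subset_left)
  exact hball.trans (interior_subset.trans (closure_mono Set.inter_subset_left))

end OpenMapping

/-! ### Subgradients and the perturbation epigraph -/

namespace SubdiffSum

theorem IsProper.exists_coe_eq {X : Type*} {f : X → EReal} (hf : IsProper f) {x : X} (hx : x ∈ effDom f) :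
    ∃ a : ℝ, f x = a :=
  ⟨(f x).toReal, (EReal.coe_toReal (ne_of_lt hx) (hf.1 x)).symm⟩

section

variable {X : Type*} [AddCommGroup X] [Module ℝ X]

theorem mem_subdiff_iff [TopologicalSpace X] {f : X → EReal} (hf : ∀ x, f x ≠ ⊥) {x₀ : X} {a₀ : ℝ}
    (h₀ : f x₀ = a₀) {φ : X →L[ℝ] ℝ} :
    φ ∈ subdiff f x₀ ↔ ∀ (x : X) (a : ℝ), f x = a → φ (x - x₀) ≤ a - a₀ := by
  refine forall_congr' fun x => ⟨fun h a ha => ?_, fun h => ?_⟩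
  · rw [h₀, ha] at h
    exact_mod_cast h
  · rw [h₀]
    rcases eq_or_ne (f x) ⊤ with ht | ht
    · rw [ht, EReal.top_sub_coe]
      exact le_top
    · rw [← EReal.coe_toReal ht (hf x)]
      exact_mod_cast h _ (EReal.coe_toReal ht (hf x)).symm

theorem IsConvexFun.le_combo {f : X → EReal} (hf : IsConvexFun f) {x y : X} {a b s t : ℝ}
    (hx : f x ≤ a) (hy : f y ≤ b) (hs : 0 ≤ s) (ht : 0 ≤ t) (hst : s + t = 1) :
    f (s • x + t • y) ≤ ((s * a + t * b : ℝ) : EReal) :=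
  hf (show (x, a) ∈ epi f from hx) (show (y, b) ∈ epi f from hy) hs ht hst

theorem IsConvexFun.convex_sublevel {f : X → EReal} (hf : IsConvexFun f) (c : ℝ) :
    Convex ℝ {x | f x ≤ c} := by
  intro x hx y hy s t hs ht hst
  have := hf.le_combo hx hy hs ht hst
  rwa [← add_mul, hst, one_mul] at this

variable [TopologicalSpace X]

theorem subdiff_add_subset [IsTopologicalAddGroup X] {f g : X → EReal} (hf : IsProper f)
    (hg : IsProper g) {x₀ : X} (hx₀ : x₀ ∈ effDom f ∩ effDom g) :
    subdiff f x₀ + subdiff g x₀ ⊆ subdiff (f + g) x₀ := by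
  rintro _ ⟨φ, hφ, ψ, hψ, rfl⟩ x
  obtain ⟨a, ha⟩ := hf.exists_coe_eq hx₀.1
  obtain ⟨b, hb⟩ := hg.exists_coe_eq hx₀.2
  have h1 := hφ x
  have h2 := hψ x
  rw [ha] at h1
  rw [hb] at h2
  rw [Pi.add_apply, Pi.add_apply, ha, hb]
  rcases eq_or_ne (f x) ⊤ with hft | hft
  · rw [hft, EReal.top_add_of_ne_bot (hg.1 x), ← EReal.coe_add, EReal.top_sub_coe]
    exact le_top
  rcases eq_or_ne (g x) ⊤ with hgt | hgt
  · rw [hgt, EReal.add_top_of_ne_bot (hf.1 x), ← EReal.coe_add, EReal.top_sub_coe]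
    exact le_top
  rw [← EReal.coe_toReal hft (hf.1 x)] at h1 ⊢
  rw [← EReal.coe_toReal hgt (hg.1 x)] at h2 ⊢
  norm_cast at h1 h2 ⊢
  rw [add_apply]
  linarith

/-- The epigraph of the value function `y ↦ inf {f u + g v - φ v | u - v = y}`, up to closing its
vertical sections. -/
def perturbationEpi (f g : X → EReal) (φ : X →L[ℝ] ℝ) : Set (X × ℝ) :=
  {p | ∃ u v : X, ∃ a b : ℝ, u - v = p.1 ∧ f u ≤ a ∧ g v ≤ b ∧ a + b - φ v ≤ p.2}

theorem convex_perturbationEpi {f g : X → EReal} (hf : IsConvexFun f) (hg : IsConvexFun g)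
    (φ : X →L[ℝ] ℝ) : Convex ℝ (perturbationEpi f g φ) := by
  rintro ⟨y, μ⟩ ⟨u, v, a, b, hy, ha, hb, hμ⟩ ⟨y', μ'⟩ ⟨u', v', a', b', hy', ha', hb', hμ'⟩
    s t hs ht hst
  refine ⟨s • u + t • u', s • v + t • v', _, _, ?_, hf.le_combo ha ha' hs ht hst,
    hg.le_combo hb hb' hs ht hst, ?_⟩
  · simp only at hy hy'
    simp only [Prod.smul_mk, Prod.mk_add_mk, ← hy, ← hy', smul_sub]
    abel
  · simp only at hμ hμ'
    simp only [Prod.smul_mk, Prod.mk_add_mk, map_add, map_smul, smul_eq_mul]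
    linarith [mul_le_mul_of_nonneg_left hμ hs, mul_le_mul_of_nonneg_left hμ' ht]

/-- Over `0` one has `u = v`, and `f + g - φ` is minimal at `x₀`. -/
theorem le_of_zero_mem_perturbationEpi {f g : X → EReal} {φ : X →L[ℝ] ℝ} {x₀ : X} {a₀ b₀ : ℝ}
    (ha₀ : f x₀ = a₀) (hb₀ : g x₀ = b₀) (hφ : φ ∈ subdiff (f + g) x₀) {μ : ℝ}
    (hμ : ((0 : X), μ) ∈ perturbationEpi f g φ) : a₀ + b₀ - φ x₀ ≤ μ := by
  obtain ⟨u, v, a, b, huv, ha, hb, hle⟩ := hμ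
  obtain rfl : u = v := sub_eq_zero.1 huv
  have h := hφ u
  have h2 : f u + g u - ((f + g) x₀) ≤ ((a + b - (a₀ + b₀) : ℝ) : EReal) := by
    rw [Pi.add_apply, ha₀, hb₀]
    push_cast
    exact EReal.sub_le_sub (add_le_add ha hb) le_rfl
  have h3 : φ (u - x₀) ≤ a + b - (a₀ + b₀) := by exact_mod_cast h.trans h2
  rw [map_sub] at h3
  simp only at hle
  linarith

/-- Freezing `v = x₀` tests `ψ` against `f`; freezing `u = x₀` tests `φ - ψ` against `g`. -/
theorem mem_add_subdiff [IsTopologicalAddGroup X] {f g : X → EReal} (hf : IsProper f)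
    (hg : IsProper g) {φ ψ : X →L[ℝ] ℝ} {x₀ : X} {a₀ b₀ : ℝ} (ha₀ : f x₀ = a₀) (hb₀ : g x₀ = b₀)
    (h : ∀ p ∈ perturbationEpi f g φ, a₀ + b₀ - φ x₀ + ψ p.1 ≤ p.2) :
    φ ∈ subdiff f x₀ + subdiff g x₀ := by
  refine ⟨ψ, (mem_subdiff_iff hf.1 ha₀).2 fun x a ha => ?_, φ - ψ,
    (mem_subdiff_iff hg.1 hb₀).2 fun x b hb => ?_, add_sub_cancel _ _⟩
  · have := h (x - x₀, a + b₀ - φ x₀) ⟨x, x₀, a, b₀, rfl, ha.le, hb₀.le, le_rfl⟩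
    simp only at this
    linarith
  · have := h (x₀ - x, a₀ + b - φ x) ⟨x₀, x, a₀, b, rfl, ha₀.le, hb.le, le_rfl⟩
    simp only [map_sub] at this
    simp only [sub_apply, map_sub]
    linarith

end

/-! ### The case of a continuity point -/

open Filter Topology in
theorem subdiff_add_of_continuousAt {X : Type*} [AddCommGroup X] [Module ℝ X] [TopologicalSpace X]
    [IsTopologicalAddGroup X] [ContinuousSMul ℝ X] {f g : X → EReal} (hf : IsProper f)
    (hg : IsProper g) (hfc : IsConvexFun f) (hgc : IsConvexFun g)
    (hcont : ∃ a ∈ effDom f ∩ effDom g, ContinuousAt f a) {x₀ : X}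
    (hx₀ : x₀ ∈ effDom f ∩ effDom g) :
    subdiff (f + g) x₀ = subdiff f x₀ + subdiff g x₀ := by
  refine Set.Subset.antisymm (fun φ hφ => ?_) (subdiff_add_subset hf hg hx₀)
  obtain ⟨a₀, ha₀⟩ := hf.exists_coe_eq hx₀.1
  obtain ⟨b₀, hb₀⟩ := hg.exists_coe_eq hx₀.2
  obtain ⟨z, ⟨hzf, hzg⟩, hz⟩ := hcont
  obtain ⟨c, hc, -⟩ := EReal.lt_iff_exists_real_btwn.1 hzf
  obtain ⟨b, hb⟩ := hg.exists_coe_eq hzg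
  have hnhds : ∀ᶠ x in 𝓝 z, f x < c := hz.eventually_lt_const hc
  have hnhds0 : ∀ᶠ y in 𝓝 (0 : X), f (y + z) < c := by
    have : Tendsto (fun y : X => y + z) (𝓝 0) (𝓝 z) := by
      simpa using (continuous_add_const z).tendsto (0 : X)
    exact this.eventually hnhds
  -- The choice `v = z`, `u = y + z` bounds `h y` by `c + b - φ z` near `0`; the `1` leaves vertical
  -- room.
  have hint : ((0 : X), c + b - φ z + 1) ∈ interior (perturbationEpi f g φ) := by
    rw [mem_interior_iff_mem_nhds]
    have h2 : ∀ᶠ μ in 𝓝 (c + b - φ z + 1), c + b - φ z < μ :=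
      eventually_gt_nhds (lt_add_one _)
    filter_upwards [hnhds0.prod_nhds h2] with p hp
    exact ⟨p.1 + z, z, c, b, add_sub_cancel_right _ _, hp.1.le, hb.le, hp.2.le⟩
  obtain ⟨ψ, hψ⟩ := (convex_perturbationEpi hfc hgc φ).exists_affine_minorant hint
    fun μ hμ => le_of_zero_mem_perturbationEpi ha₀ hb₀ hφ hμ
  exact mem_add_subdiff hf hg ha₀ hb₀ hψ

/-! ### The Banach space case -/

section Banach

variable {X : Type*} [NormedAddCommGroup X] [NormedSpace ℝ X] [CompleteSpace X]

theorem exists_bound_near_zero {f g : X → EReal} (hfc : IsConvexFun f) (hgc : IsConvexFun g)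
    (hfl : LowerSemicontinuous f) (hgl : LowerSemicontinuous g) {L : Submodule ℝ X}
    (hL : IsClosed (L : Set X)) (hLeq : (L : Set X) = posCone (effDom f - effDom g))
    (φ : X →L[ℝ] ℝ) :
    ∃ M : ℝ, ∃ r > 0, ∀ y ∈ L, ‖y‖ < r →
      ∃ u v : X, u - v = y ∧ f u ≤ M ∧ g v ≤ M ∧ -φ v ≤ M := by
  let d : X × X →L[ℝ] X := ContinuousLinearMap.fst ℝ X X - ContinuousLinearMap.snd ℝ X X
  -- Restricting to pairs with difference in `L` makes the difference map act between Banach spaces.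
  let K : Submodule ℝ (X × X) := L.comap (d : X × X →ₗ[ℝ] X)
  have hK : IsClosed (K : Set (X × X)) := hL.preimage d.continuous
  have : CompleteSpace L := hL.completeSpace_coe
  have : CompleteSpace K := hK.completeSpace_coe
  let T : K →L[ℝ] L := (d.comp K.subtypeL).codRestrict L fun k => k.2
  let u : K →L[ℝ] X := (ContinuousLinearMap.fst ℝ X X).comp K.subtypeL
  let v : K →L[ℝ] X := (ContinuousLinearMap.snd ℝ X X).comp K.subtypeL
  let S : ℕ → Set K := fun n =>
    u ⁻¹' {x | f x ≤ ((n : ℝ) : EReal)} ∩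
      (v ⁻¹' {x | g x ≤ ((n : ℝ) : EReal)} ∩ v ⁻¹' {x | -φ x ≤ n})
  have hmono : Monotone S := by
    intro m n hmn k hk
    have h : (m : ℝ) ≤ n := by exact_mod_cast hmn
    have hE : ((m : ℝ) : EReal) ≤ ((n : ℝ) : EReal) := EReal.coe_le_coe_iff.2 h
    exact ⟨le_trans hk.1 hE, le_trans hk.2.1 hE, le_trans hk.2.2 h⟩
  have hconv : ∀ n, Convex ℝ (S n) := by
    intro n
    refine ((hfc.convex_sublevel n).linear_preimage (u : K →ₗ[ℝ] X)).inter
      (((hgc.convex_sublevel n).linear_preimage (v : K →ₗ[ℝ] X)).inter ?_)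
    exact (convex_halfSpace_le (-φ : X →L[ℝ] ℝ).isLinear n).linear_preimage (v : K →ₗ[ℝ] X)
  have hclosed : ∀ n, IsClosed (S n) := by
    intro n
    refine ((hfl.isClosed_preimage _).preimage u.continuous).inter
      (((hgl.isClosed_preimage _).preimage v.continuous).inter ?_)
    exact (isClosed_le (by fun_prop) continuous_const).preimage v.continuous
  have habs : ∀ y : L, ∃ t : ℝ, 0 < t ∧ ∃ n, ∃ k ∈ S n, y = t • T k := by
    rintro ⟨y, hy⟩
    have hy' : y ∈ posCone (effDom f - effDom g) := hLeq ▸ hy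
    obtain ⟨t, ht, _, ⟨p, hp, q, hq, rfl⟩, rfl⟩ := hy'
    obtain ⟨a, ha, -⟩ := EReal.lt_iff_exists_real_btwn.1 (show f p < ⊤ from hp)
    obtain ⟨b, hb, -⟩ := EReal.lt_iff_exists_real_btwn.1 (show g q < ⊤ from hq)
    obtain ⟨n, hn⟩ := exists_nat_ge (max a (max b (-φ q)))
    have hpq : p - q ∈ L := by
      rw [← SetLike.mem_coe, hLeq]
      exact ⟨1, one_pos, _, ⟨p, hp, q, hq, rfl⟩, (one_smul ℝ _).symm⟩
    refine ⟨t, ht, n, ⟨(p, q), hpq⟩, ⟨?_, ?_, ?_⟩, rfl⟩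
    · exact ha.le.trans (EReal.coe_le_coe_iff.2 ((le_max_left _ _).trans hn))
    · exact hb.le.trans
        (EReal.coe_le_coe_iff.2 ((le_max_left _ _).trans ((le_max_right _ _).trans hn)))
    · exact (le_max_right _ _).trans ((le_max_right _ _).trans hn)
  obtain ⟨n, r, hr, hball⟩ :=
    exists_ball_subset_image_of_absorbing T hmono hconv hclosed habs
  refine ⟨n, r, hr, fun y hy hyr => ?_⟩
  obtain ⟨k, hk, hTk⟩ := hball (show (⟨y, hy⟩ : L) ∈ Metric.ball 0 r by simpa using hyr)
  exact ⟨u k, v k, congrArg Subtype.val hTk, hk.1, hk.2.1, hk.2.2⟩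

open Filter Topology in
theorem subdiff_add_of_isClosed_posCone {f g : X → EReal} (hf : IsProper f)
    (hg : IsProper g) (hfc : IsConvexFun f) (hgc : IsConvexFun g)
    (hfl : LowerSemicontinuous f) (hgl : LowerSemicontinuous g) {L : Submodule ℝ X}
    (hL : IsClosed (L : Set X)) (hLeq : (L : Set X) = posCone (effDom f - effDom g)) {x₀ : X}
    (hx₀ : x₀ ∈ effDom f ∩ effDom g) :
    subdiff (f + g) x₀ = subdiff f x₀ + subdiff g x₀ := by
  refine Set.Subset.antisymm (fun φ hφ => ?_) (subdiff_add_subset hf hg hx₀)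
  obtain ⟨a₀, ha₀⟩ := hf.exists_coe_eq hx₀.1
  obtain ⟨b₀, hb₀⟩ := hg.exists_coe_eq hx₀.2
  obtain ⟨M, r, hr, hM⟩ := exists_bound_near_zero hfc hgc hfl hgl hL hLeq φ
  -- The epigraph lies over `L`, so it can have interior points only relative to `L × ℝ` when `L` is
  -- proper.
  let j : L × ℝ →ₗ[ℝ] X × ℝ := L.subtype.prodMap LinearMap.id
  have hint : ((0 : L), M + M + M + 1) ∈ interior (j ⁻¹' perturbationEpi f g φ) := by
    rw [mem_interior_iff_mem_nhds]
    have h1 : ∀ᶠ y in 𝓝 (0 : L), ‖y‖ < r := by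
      filter_upwards [Metric.ball_mem_nhds (0 : L) hr] with y hy using mem_ball_zero_iff.1 hy
    have h2 : ∀ᶠ μ in 𝓝 (M + M + M + 1), M + M + M < μ := eventually_gt_nhds (lt_add_one _)
    filter_upwards [h1.prod_nhds h2] with p hp
    obtain ⟨u, v, huv, hu, hv, hφv⟩ := hM p.1 p.1.2 hp.1
    have hp2 : M + M + M < p.2 := hp.2
    exact ⟨u, v, M, M, huv, hu, hv, show M + M - φ v ≤ p.2 by linarith⟩
  obtain ⟨ψ, hψ⟩ := ((convex_perturbationEpi hfc hgc φ).linear_preimage j).exists_affine_minorant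
    hint fun μ hμ => le_of_zero_mem_perturbationEpi ha₀ hb₀ hφ hμ
  obtain ⟨ψ', hψ', -⟩ := exists_extension_norm_eq L ψ
  refine mem_add_subdiff (ψ := ψ') hf hg ha₀ hb₀ fun p hp => ?_
  have hpL : p.1 ∈ L := by
    obtain ⟨u, v, a, b, huv, ha, hb, -⟩ := hp
    rw [← SetLike.mem_coe, hLeq, ← huv]
    exact ⟨1, one_pos, _, ⟨u, ha.trans_lt (EReal.coe_lt_top a), v,
      hb.trans_lt (EReal.coe_lt_top b), rfl⟩, (one_smul ℝ _).symm⟩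
  have := hψ (⟨p.1, hpL⟩, p.2) hp
  rwa [← hψ' ⟨p.1, hpL⟩] at this

end Banach

end SubdiffSum

theorem theorem6p1 :
    -- separated locally convex spaces: `f` is finite and continuous at some point of `dom f ∩ dom g`
    (∀ (X : Type*) [AddCommGroup X] [Module ℝ X] [TopologicalSpace X] [IsTopologicalAddGroup X]
        [ContinuousSMul ℝ X] [LocallyConvexSpace ℝ X] [T2Space X] (f g : X → EReal),
        IsProper f → IsProper g → IsConvexFun f → IsConvexFun g →
        (∃ a ∈ effDom f ∩ effDom g, ContinuousAt f a) →
        ∀ x₀ ∈ effDom f ∩ effDom g, subdiff (f + g) x₀ = subdiff f x₀ + subdiff g x₀) ∧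
    -- Banach spaces: `f`, `g` are l.s.c. and `ℝ⁺(dom f - dom g)` is a closed subspace
    (∀ (X : Type*) [NormedAddCommGroup X] [NormedSpace ℝ X] [CompleteSpace X] (f g : X → EReal),
        IsProper f → IsProper g → IsConvexFun f → IsConvexFun g →
        LowerSemicontinuous f → LowerSemicontinuous g →
        (∃ L : Submodule ℝ X, IsClosed (L : Set X) ∧
          (L : Set X) = posCone (effDom f - effDom g)) →
        ∀ x₀ ∈ effDom f ∩ effDom g, subdiff (f + g) x₀ = subdiff f x₀ + subdiff g x₀) :=
  ⟨fun _ _ _ _ _ _ _ _ _ _ hf hg hfc hgc hcont _ hx₀ =>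
      subdiff_add_of_continuousAt hf hg hfc hgc hcont hx₀,
    fun _ _ _ _ _ _ hf hg hfc hgc hfl hgl ⟨_, hL, hLeq⟩ _ hx₀ =>
      subdiff_add_of_isClosed_posCone hf hg hfc hgc hfl hgl hL hLeq hx₀⟩
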